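/- Work with $8\times 8$ complex matrices, viewed as elements of $M_2\otimes M_2\otimes M_2$ (subsystems $A,B,C$) with the basis $|000\rangle,|001\rangle,\dots,|111\rangle$ of $\mathbb C^2\otimes\mathbb C^2\otimes\mathbb C^2$ in lexicographic order. A (possibly un-normalized) three-qubit state is a positive semidefinite such matrix. Let $\alpha$, $\beta$, $\gamma$ be the convex cones of un-normalized $A$-$BC$, $B$-$CA$ and $C$-$AB$ separable states, that is, of all finite sums of matrices $|\psi\rangle\langle\psi|$ with $\psi$ a product vector for the respective bipartition (the zero matrix included). For convex cones, $\wedge$ denotes intersection and $\vee$ denotes convex hull (equivalently, sum). For $a,b\in\mathbb R^4$ and $z\in\mathbb C^4$ let $\mathsf X(a,b,z)$ be the matrix with diagonal $(a_1,a_2,a_3,a_4,b_4,b_3,b_2,b_1)$, with anti-diagonal (from the upper right to the lower left corner) $(z_1,z_2,z_3,z_4,\bar z_4,\bar z_3,\bar z_2,\bar z_1)$, and with all other entries zero. The $\mathsf X$-part of a matrix is obtained by replacing by $0$ all entries off the diagonal and the anti-diagonal. For indices in $\{1,2,3,4\}$ consider the inequalities $$S_1[i,j]:\quad \min\{\sqrt{a_ib_i},\sqrt{a_jb_j}\}\ge\max\{|z_i|,|z_j|\},$$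 $$S_4[i,j|k,\ell]:\quad \min\{\sqrt{a_ib_i}+\sqrt{a_jb_j},\ \sqrt{a_kb_k}+\sqrt{a_\ell b_\ell}\}\ge\max\{|z_i|+|z_j|,\ |z_k|+|z_\ell|\}.$$ A pair $\{i,j\}$ always means a set of two distinct indices. **Theorem 3.1.** Let $\varrho$ be a three-qubit state with $\mathsf X$-part $\mathsf X(a,b,z)$. (i) If $\varrho\in(\alpha\wedge\beta)\vee(\alpha\wedge\gamma)$, then $S_1[1,4]$, $S_1[2,3]$, and $S_4[i,j|k,\ell]$ for any two different pairs $\{i,j\}$ and $\{k,\ell\}$, hold. (ii) If $\varrho\in(\beta\wedge\gamma)\vee(\beta\wedge\alpha)$, then $S_1[1,3]$, $S_1[2,4]$, and $S_4[i,j|k,\ell]$ for any two different pairs $\{i,j\}$ and $\{k,\ell\}$, hold. (iii) If $\varrho\in(\gamma\wedge\alpha)\vee(\gamma\wedge\beta)$, then $S_1[1,2]$, $S_1[3,4]$, and $S_4[i,j|k,\ell]$ for any two different pairs $\{i,j\}$ and $\{k,\ell\}$, hold. If moreover $\varrho=\mathsf X(a,b,z)$, then the converses of (i), (ii) and (iii)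 also hold. -/

import Mathlib

open scoped ComplexOrder

noncomputable section

namespace ThreeQubit

/-- Labels `(i, j, k)` of the standard basis of `ℂ² ⊗ ℂ² ⊗ ℂ²` (subsystems `A`, `B`, `C`). -/
abbrev Idx : Type := Fin 2 × Fin 2 × Fin 2

/-- Elements of `M₂ ⊗ M₂ ⊗ M₂`, as matrices indexed by basis labels. -/
abbrev Mat : Type := Matrix Idx Idx ℂ

/-- The rank one matrix `|ψ⟩⟨ψ|`. -/
def rankOne (ψ : Idx → ℂ) : Mat := Matrix.vecMulVec ψ (star ψ)

/-- The convex cone of un-normalized `A`-`BC` separable states: nonnegative combinations of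
`|ψ⟩⟨ψ|` with `ψ = x ⊗ y`, `x` in the space of `A` and `y` in the space of `BC`. -/
def alpha : PointedCone ℝ Mat :=
  PointedCone.hull ℝ {ρ | ∃ (x : Fin 2 → ℂ) (y : Fin 2 × Fin 2 → ℂ),
    ρ = rankOne fun p => x p.1 * y (p.2.1, p.2.2)}

/-- The convex cone of un-normalized `B`-`CA` separable states. -/
def beta : PointedCone ℝ Mat :=
  PointedCone.hull ℝ {ρ | ∃ (x : Fin 2 → ℂ) (y : Fin 2 × Fin 2 → ℂ),
    ρ = rankOne fun p => x p.2.1 * y (p.2.2, p.1)}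

/-- The convex cone of un-normalized `C`-`AB` separable states. -/
def gamma : PointedCone ℝ Mat :=
  PointedCone.hull ℝ {ρ | ∃ (x : Fin 2 → ℂ) (y : Fin 2 × Fin 2 → ℂ),
    ρ = rankOne fun p => x p.2.2 * y (p.1, p.2.1)}

/-- Position (counted from `0`) of a basis label in the lexicographic order. -/
def lex (p : Idx) : Fin 8 :=
  ![![![0, 1], ![2, 3]], ![![4, 5], ![6, 7]]] p.1 p.2.1 p.2.2

theorem lex_val (p : Idx) : (lex p : ℕ) = 4 * p.1 + 2 * p.2.1 + p.2.2 := by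
  revert p; decide

/-- The `X`-shaped self-adjoint matrix `X(a, b, z)`. The indices `1, 2, 3, 4` of the entries of
`a`, `b`, `z` are `0, 1, 2, 3` here. -/
def X (a b : Fin 4 → ℝ) (z : Fin 4 → ℂ) : Mat :=
  (!![(a 0 : ℂ), 0, 0, 0, 0, 0, 0, z 0;
      0, (a 1 : ℂ), 0, 0, 0, 0, z 1, 0;
      0, 0, (a 2 : ℂ), 0, 0, z 2, 0, 0;
      0, 0, 0, (a 3 : ℂ), z 3, 0, 0, 0;
      0, 0, 0, star (z 3), (b 3 : ℂ), 0, 0, 0;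
      0, 0, star (z 2), 0, 0, (b 2 : ℂ), 0, 0;
      0, star (z 1), 0, 0, 0, 0, (b 1 : ℂ), 0;
      star (z 0), 0, 0, 0, 0, 0, 0, (b 0 : ℂ)] : Matrix (Fin 8) (Fin 8) ℂ).submatrix lex lex

/-- The `X`-part of a matrix: keep the diagonal and anti-diagonal entries (in the lexicographic
order), and replace all the others by zero. -/
def xPart (ρ : Mat) : Mat :=
  Matrix.of fun p q => if lex q = lex p ∨ lex q = (lex p).rev then ρ p q else 0

/-- The inequality `S₁[i, j]`. -/
def S1 (a b : Fin 4 → ℝ) (z : Fin 4 → ℂ) (i j : Fin 4) : Prop :=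
  min √(a i * b i) √(a j * b j) ≥ max ‖z i‖ ‖z j‖

/-- The inequality `S₄[i, j | k, l]`. -/
def S4 (a b : Fin 4 → ℝ) (z : Fin 4 → ℂ) (i j k l : Fin 4) : Prop :=
  min (√(a i * b i) + √(a j * b j)) (√(a k * b k) + √(a l * b l)) ≥
    max (‖z i‖ + ‖z j‖) (‖z k‖ + ‖z l‖)

/-- `S₄[i, j | k, l]` holds for any two different pairs `{i, j}`, `{k, l}`, a pair being a set of
exactly two indices. -/
def AllS4 (a b : Fin 4 → ℝ) (z : Fin 4 → ℂ) : Prop :=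
  ∀ i j k l : Fin 4, i ≠ j → k ≠ l → ({i, j} : Finset (Fin 4)) ≠ {k, l} → S4 a b z i j k l

end ThreeQubit

end

noncomputable section

namespace ThreeQubit

/-! Write sᵢ = √(aᵢbᵢ) and rᵢ = |zᵢ|. Partial transposition of one qubit permutes the four
anti-diagonal indices; the three involutions obtained (`matchA`, `matchB`, `matchC`) and the
identity send each index to four distinct ones. An X-matrix with nonnegative diagonal lies in the
cone of one bipartition as soon as r p ≤ s p and r (m p) ≤ s p for its involution m
(`xMat_mem_alpha`, transported by cyclic symmetry). For two bipartitions at once, this says that r p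
≤ s q except possibly when q is the image of p under the third involution (`Dominates`).

Necessity: the moduli are subadditive and the geometric means superadditive, so bounds that hold on
product vectors hold on the cones (`bounds_of_mem_hull`). A summand lying in two cones satisfies
`Dominates`, hence all two-term inequalities (`Dominates.add_le_add`), and these add up over the two
summands.

Sufficiency: if some r i exceeds s (m₃ i), the excess is moved into a first summand in such a way
that the S₄ inequalities are exactly what the remainder needs (`exists_split`). Rescaling aᵢ, bᵢ and
zᵢ turns this splitting of moduli into one of matrices (`X_mem_sup`). -/

/-! ### X-shaped matrices in the cone `alpha` -/

/-- Flip all three bits of a basis label. -/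
def bar (p : Idx) : Idx := (p.1 + 1, p.2.1 + 1, p.2.2 + 1)

/-- The matrix with diagonal `d` and anti-diagonal `w`. -/
def xMat (d : Idx → ℝ) (w : Idx → ℂ) : Mat :=
  Matrix.of fun p q => if q = p then (d p : ℂ) else if q = bar p then w p else 0

theorem xMat_add (d d' : Idx → ℝ) (w w' : Idx → ℂ) :
    xMat (d + d') (w + w') = xMat d w + xMat d' w' := by
  ext p q
  simp only [xMat, Matrix.of_apply, Matrix.add_apply, Pi.add_apply]
  split_ifs <;> simp

theorem xMat_smul (t : ℝ) (d : Idx → ℝ) (w : Idx → ℂ) :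
    xMat (t • d) (t • w) = t • xMat d w := by
  ext p q
  simp only [xMat, Matrix.of_apply, Matrix.smul_apply, Pi.smul_apply]
  split_ifs <;> simp

theorem rankOne_mem_alpha (x : Fin 2 → ℂ) (y : Fin 2 × Fin 2 → ℂ) :
    rankOne (fun p => x p.1 * y (p.2.1, p.2.2)) ∈ alpha :=
  Submodule.subset_span ⟨x, y, rfl⟩

theorem smul_mem_cone (C : PointedCone ℝ Mat) {t : ℝ} (ht : 0 ≤ t) {ρ : Mat} (h : ρ ∈ C) :
    t • ρ ∈ C :=
  C.smul_mem ht h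

theorem xMat_diagonal_mem_alpha {d : Idx → ℝ} (hd : ∀ p, 0 ≤ d p) : xMat d 0 ∈ alpha := by
  have key : xMat d 0 = ∑ p : Idx, d p •
      rankOne (fun q => (Pi.single p.1 1 : Fin 2 → ℂ) q.1 *
        (Pi.single p.2 1 : Fin 2 × Fin 2 → ℂ) (q.2.1, q.2.2)) := by
    have hs : ∀ p q : Idx, (Pi.single p.1 1 : Fin 2 → ℂ) q.1 *
        (Pi.single p.2 1 : Fin 2 × Fin 2 → ℂ) (q.2.1, q.2.2) = if q = p then 1 else 0 := by
      rintro ⟨p1, p2⟩ ⟨q1, q2⟩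
      simp only [Pi.single_apply, Prod.mk.eta, Prod.mk.injEq]
      split_ifs <;> simp_all
    ext q q'
    simp only [hs, Matrix.sum_apply, Matrix.smul_apply, rankOne, Matrix.vecMulVec_apply,
      Pi.star_apply]
    rw [Finset.sum_eq_single q]
    · simp only [xMat, Matrix.of_apply, Pi.zero_apply, ite_self]
      split_ifs <;> simp
    · intro p _ hp
      simp [Ne.symm hp]
    · simp
  rw [key]
  exact sum_mem fun p _ => smul_mem_cone _ (hd p) (rankOne_mem_alpha _ _)

theorem xMat_mem_alpha_mono {d d' : Idx → ℝ} {w : Idx → ℂ} (h : xMat d w ∈ alpha)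
    (hd : ∀ p, d p ≤ d' p) : xMat d' w ∈ alpha := by
  have := add_mem h (xMat_diagonal_mem_alpha (d := d' - d) fun p => sub_nonneg.2 (hd p))
  rwa [← xMat_add, add_sub_cancel, add_zero] at this

/-- Average the projector onto a product vector with its conjugate by a sign change of the label 1
in both factors: only entries whose two bits are both kept or both flipped survive. -/
theorem xMat_product_mem_alpha (c : Fin 2) (x v : Fin 2 → ℂ) :
    xMat (fun p => if p.2.2 = p.2.1 + c then ‖x p.1‖ ^ 2 * ‖v p.2.1‖ ^ 2 else 0)
      (fun p => if p.2.2 = p.2.1 + c then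
        x p.1 * v p.2.1 * star (x (p.1 + 1) * v (p.2.1 + 1)) else 0) ∈ alpha := by
  have h1 := rankOne_mem_alpha x fun q => if q.2 = q.1 + c then v q.1 else 0
  have h2 := rankOne_mem_alpha ![x 0, -x 1] fun q => if q.2 = q.1 + c then ![v 0, -v 1] q.1 else 0
  convert smul_mem_cone _ (by norm_num : (0 : ℝ) ≤ 1 / 2) (add_mem h1 h2) using 1
  have hn (u : ℂ) : (‖u‖ : ℂ) ^ 2 = u * star u := (Complex.mul_conj' u).symm
  ext ⟨p1, p2, p3⟩ ⟨q1, q2, q3⟩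
  simp only [xMat, bar, rankOne, Matrix.of_apply, Matrix.smul_apply, Matrix.add_apply,
    Matrix.vecMulVec_apply, Pi.star_apply]
  fin_cases c <;> fin_cases p1 <;> fin_cases p2 <;> fin_cases p3 <;> fin_cases q1 <;>
    fin_cases q2 <;> fin_cases q3 <;> simp [hn] <;> ring

/-- A point of the disc of radius r is the midpoint of a chord: rotate z/|z| by the angles
±arccos(|z|/r). -/
theorem exists_unimodular_average {z : ℂ} {r : ℝ} (h : ‖z‖ ≤ r) :
    ∃ u v : ℂ, ‖u‖ = 1 ∧ ‖v‖ = 1 ∧ z = (1 / 2 : ℝ) • (r * u + r * v) := by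
  rcases eq_or_ne z 0 with rfl | hz
  · exact ⟨1, -1, by simp, by simp, by simp⟩
  have hn : 0 < ‖z‖ := norm_pos_iff.2 hz
  have hr : 0 < r := hn.trans_le h
  have hnc : (‖z‖ : ℂ) ≠ 0 := by exact_mod_cast hn.ne'
  have hrc : (r : ℂ) ≠ 0 := by exact_mod_cast hr.ne'
  have hcos : Real.cos (Real.arccos (‖z‖ / r)) = ‖z‖ / r :=
    Real.cos_arccos (by have := div_nonneg hn.le hr.le; linarith) ((div_le_one hr).2 h)
  have hsum : Complex.exp ((Real.arccos (‖z‖ / r) : ℝ) * Complex.I) +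
      Complex.exp ((-Real.arccos (‖z‖ / r) : ℝ) * Complex.I) = 2 * (‖z‖ / r : ℝ) := by
    have := Complex.two_cos (Real.arccos (‖z‖ / r))
    rw [← Complex.ofReal_cos, hcos] at this
    rw [this]
    push_cast
    rfl
  refine ⟨z / ‖z‖ * Complex.exp ((Real.arccos (‖z‖ / r) : ℝ) * Complex.I),
    z / ‖z‖ * Complex.exp ((-Real.arccos (‖z‖ / r) : ℝ) * Complex.I), ?_, ?_, ?_⟩
  · rw [norm_mul, Complex.norm_exp_ofReal_mul_I]; simp [hn.ne']
  · rw [norm_mul, Complex.norm_exp_ofReal_mul_I]; simp [hn.ne']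
  · rw [← mul_add, ← mul_add, hsum, Complex.real_smul]
    push_cast
    field_simp

theorem exists_unimodular_factors {u v : ℂ} (hu : ‖u‖ = 1) (hv : ‖v‖ = 1) :
    ∃ ξ η : ℂ, ‖ξ‖ = 1 ∧ ‖η‖ = 1 ∧ star (ξ * η) = u ∧ η * star ξ = v := by
  -- Multiplying star (ξη) = u, conjugated, by η * star ξ = v forces η² = v * star u.
  obtain ⟨η, hη⟩ := IsAlgClosed.exists_pow_nat_eq (v * star u) (n := 2) (by norm_num)
  have hη1 : ‖η‖ = 1 := by
    have : ‖η‖ ^ 2 = 1 := by rw [← norm_pow, hη, norm_mul, norm_star, hu, hv, one_mul]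
    exact (pow_eq_one_iff_of_nonneg (norm_nonneg _) two_ne_zero).1 this
  have hs (y : ℂ) (hy : ‖y‖ = 1) : y * star y = 1 := by
    have := Complex.mul_conj' y
    rw [hy] at this
    simpa using this
  refine ⟨star v * η, η, by rw [norm_mul, norm_star, hv, hη1, one_mul], hη1, ?_, ?_⟩
  · have : star (star v * η * η) = v * star (η ^ 2) := by simp; ring
    rw [this, hη, star_mul, star_star]
    linear_combination u * hs v hv
  · rw [star_mul, star_star]
    linear_combination v * hs η hη1

/-- Flip the first bit of a basis label. -/
def flipA (p : Idx) : Idx := (p.1 + 1, p.2)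

/-- A block is a two-qubit X-matrix. With anti-diagonal moduli all equal to r, it is the X-part of
the projector onto (1, kξ) ⊗ (s, tη), up to a nonnegative diagonal: s and t fit the upper diagonal,
k = r/(st) fits the modulus, ξ and η fit the phases. -/
theorem xMat_block_mem_alpha_of_unimodular (c : Fin 2) {d : Idx → ℝ} {r : ℝ} {u v : ℂ}
    (hr : 0 ≤ r) (hd : ∀ p, 0 ≤ d p) (hu : ‖u‖ = 1) (hv : ‖v‖ = 1)
    (h1 : r ^ 2 ≤ d (0, 0, c) * d (1, 1, 1 + c)) (h4 : r ^ 2 ≤ d (0, 1, 1 + c) * d (1, 0, c)) :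
    xMat (fun p => if p.2.2 = p.2.1 + c then d p else 0)
      (fun p => if p.2.2 = p.2.1 + c then
        (!![r * u, r * v; r * star v, r * star u] : Matrix (Fin 2) (Fin 2) ℂ) p.1 p.2.1 else 0) ∈
      alpha := by
  obtain ⟨ξ, η, hξ, hη, rfl, rfl⟩ := exists_unimodular_factors hu hv
  set s := √(d (0, 0, c)) with hs
  set t := √(d (0, 1, 1 + c)) with ht
  have hs2 : s ^ 2 = d (0, 0, c) := Real.sq_sqrt (hd _)
  have ht2 : t ^ 2 = d (0, 1, 1 + c) := Real.sq_sqrt (hd _)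
  have hs0 : 0 ≤ s := Real.sqrt_nonneg _
  have ht0 : 0 ≤ t := Real.sqrt_nonneg _
  rw [← hs2] at h1
  rw [← ht2] at h4
  -- If st = 0, the quotient is 0 by convention, and `h1` or `h4` forces r = 0.
  have hrs : s * t * (r / (s * t)) = r := by
    by_cases h : s * t = 0
    · have : r = 0 := by
        rcases mul_eq_zero.1 h with h | h
        · rw [h] at h1; nlinarith
        · rw [h] at h4; nlinarith
      simp [this]
    · exact mul_div_cancel_of_imp' fun h' => absurd h' h
  have hrsC : (s : ℂ) * t * (r / (s * t)) = r := by exact_mod_cast hrs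
  have key := xMat_product_mem_alpha c ![1, (r / (s * t) : ℝ) * ξ] ![(s : ℂ), t * η]
  set k := r / (s * t) with hk
  have hk0 : 0 ≤ k := by positivity
  have hkC : (k : ℂ) = r / (s * t) := by rw [hk]; push_cast; rfl
  rw [← hkC] at hrsC
  have e1 : (k * t) ^ 2 ≤ d (1, 1, 1 + c) := by
    rcases hs0.eq_or_lt with h | h
    · rw [hk, ← h]; simpa using hd _
    · have : (s * t * k) ^ 2 ≤ s ^ 2 * d (1, 1, 1 + c) := by rw [hrs]; exact h1
      nlinarith [sq_pos_of_pos h]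
  have e2 : (k * s) ^ 2 ≤ d (1, 0, c) := by
    rcases ht0.eq_or_lt with h | h
    · rw [hk, ← h]; simpa using hd _
    · have : (s * t * k) ^ 2 ≤ t ^ 2 * d (1, 0, c) := by rw [hrs]; exact h4
      nlinarith [sq_pos_of_pos h]
  have hw : (fun p : Idx => if p.2.2 = p.2.1 + c then
        (!![r * star (ξ * η), r * (η * star ξ); r * star (η * star ξ), r * star (star (ξ * η))] :
          Matrix (Fin 2) (Fin 2) ℂ) p.1 p.2.1 else 0) =
      fun p => if p.2.2 = p.2.1 + c then
        (![1, (k : ℂ) * ξ] : Fin 2 → ℂ) p.1 * (![(s : ℂ), t * η] : Fin 2 → ℂ) p.2.1 *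
          star ((![1, (k : ℂ) * ξ] : Fin 2 → ℂ) (p.1 + 1) *
            (![(s : ℂ), t * η] : Fin 2 → ℂ) (p.2.1 + 1)) else 0 := by
    funext ⟨p1, p2, p3⟩
    rw [← hrsC]
    congr 1
    fin_cases p1 <;> fin_cases p2 <;> simp <;> ring
  rw [hw]
  refine xMat_mem_alpha_mono key ?_
  rintro ⟨p1, p2, p3⟩
  dsimp only
  split_ifs with hp
  · subst hp
    fin_cases p1 <;> fin_cases p2 <;> simp [hξ, hη, abs_of_nonneg, hk0, hs0, ht0]
    · exact hs2.le
    · exact ht2.le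
    · rw [← mul_pow]; exact e2
    · rw [← mul_pow]; exact e1
  · rfl

theorem xMat_block_mem_alpha (c : Fin 2) {d : Idx → ℝ} {w : Idx → ℂ} (hd : ∀ p, 0 ≤ d p)
    (hw : ∀ p, w (bar p) = star (w p)) (h : ∀ p, ‖w p‖ ^ 2 ≤ d p * d (bar p))
    (h' : ∀ p, ‖w (flipA p)‖ ^ 2 ≤ d p * d (bar p)) :
    xMat (fun p => if p.2.2 = p.2.1 + c then d p else 0)
      (fun p => if p.2.2 = p.2.1 + c then w p else 0) ∈ alpha := by
  have hf : flipA (0, 0, c) = bar (0, 1, 1 + c) := by revert c; decide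
  have hf' : flipA (0, 1, 1 + c) = bar (0, 0, c) := by revert c; decide
  have hb : bar (0, 0, c) = (1, 1, 1 + c) := by revert c; decide
  have hb' : bar (0, 1, 1 + c) = (1, 0, c) := by revert c; decide
  have a1 := h (0, 0, c)
  have a2 := h' (0, 0, c)
  have a3 := h (0, 1, 1 + c)
  have a4 := h' (0, 1, 1 + c)
  rw [hf, hw, norm_star] at a2
  rw [hf', hw, norm_star] at a4
  rw [hb] at a1 a2
  rw [hb'] at a3 a4
  -- Both diagonal products dominate the square of the larger modulus, so each of the two entries is
  -- an average of two phases times this same r.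
  set r := max ‖w (0, 0, c)‖ ‖w (0, 1, 1 + c)‖ with hr
  have hr1 : r ^ 2 ≤ d (0, 0, c) * d (1, 1, 1 + c) := by
    rcases max_choice ‖w (0, 0, c)‖ ‖w (0, 1, 1 + c)‖ with e | e <;> rw [hr, e] <;> assumption
  have hr4 : r ^ 2 ≤ d (0, 1, 1 + c) * d (1, 0, c) := by
    rcases max_choice ‖w (0, 0, c)‖ ‖w (0, 1, 1 + c)‖ with e | e <;> rw [hr, e] <;> assumption
  have hr0 : 0 ≤ r := (norm_nonneg _).trans (le_max_left _ _)
  obtain ⟨u, u', hu, hu', e1⟩ := exists_unimodular_average (le_max_left _ _ : ‖w (0, 0, c)‖ ≤ r)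
  obtain ⟨v, v', hv, hv', e4⟩ :=
    exists_unimodular_average (le_max_right _ _ : ‖w (0, 1, 1 + c)‖ ≤ r)
  have m1 := xMat_block_mem_alpha_of_unimodular c hr0 hd hu hv hr1 hr4
  have m2 := xMat_block_mem_alpha_of_unimodular c hr0 hd hu' hv' hr1 hr4
  have := smul_mem_cone _ (by norm_num : (0 : ℝ) ≤ 1 / 2) (add_mem m1 m2)
  rw [← xMat_add, ← xMat_smul] at this
  convert this using 2
  · funext p
    simp only [Pi.smul_apply, Pi.add_apply, smul_eq_mul]
    ring
  · funext ⟨p1, p2, p3⟩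
    simp only [Pi.smul_apply, Pi.add_apply]
    split_ifs with hp
    · subst hp
      have e1' := congrArg star e1
      have e4' := congrArg star e4
      rw [← hw, hb] at e1'
      rw [← hw, hb'] at e4'
      fin_cases p1 <;> fin_cases p2 <;> simp at e1 e4 e1' e4' ⊢ <;> assumption
    · simp

theorem xMat_mem_alpha {d : Idx → ℝ} {w : Idx → ℂ} (hd : ∀ p, 0 ≤ d p)
    (hw : ∀ p, w (bar p) = star (w p)) (h : ∀ p, ‖w p‖ ^ 2 ≤ d p * d (bar p))
    (h' : ∀ p, ‖w (flipA p)‖ ^ 2 ≤ d p * d (bar p)) : xMat d w ∈ alpha := by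
  have hc (p : Idx) : p.2.2 = p.2.1 + 1 ↔ ¬ p.2.2 = p.2.1 + 0 := by revert p; decide
  -- The labels with equal last two bits and those with different ones are each stable under `bar`,
  -- so the matrix is a sum of two blocks.
  convert add_mem (xMat_block_mem_alpha 0 hd hw h h') (xMat_block_mem_alpha 1 hd hw h h') using 1
  rw [← xMat_add]
  congr 1 <;> funext p <;> simp only [Pi.add_apply, hc p] <;> split_ifs <;> simp

/-! ### Transfer to `beta` and `gamma` by cyclic symmetry -/

/-- The cyclic rotation of the three bits of a basis label. -/
def rot : Idx ≃ Idx where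
  toFun p := (p.2.1, p.2.2, p.1)
  invFun p := (p.2.2, p.1, p.2.1)
  left_inv _ := rfl
  right_inv _ := rfl

theorem map_rot_mem {S T : Set Mat} (hST : ∀ ρ ∈ S, ρ.submatrix rot rot ∈ T) {ρ : Mat}
    (h : ρ ∈ PointedCone.hull ℝ S) : ρ.submatrix rot rot ∈ PointedCone.hull ℝ T := by
  induction h using Submodule.span_induction with
  | mem ρ h => exact Submodule.subset_span (hST ρ h)
  | zero => exact zero_mem _
  | add ρ σ _ _ h₁ h₂ => exact add_mem h₁ h₂
  | smul t ρ _ h => exact Submodule.smul_mem _ t h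

theorem map_rot_mem_beta {ρ : Mat} (h : ρ ∈ alpha) : ρ.submatrix rot rot ∈ beta :=
  map_rot_mem (by rintro _ ⟨x, y, rfl⟩; exact ⟨x, y, rfl⟩) h

theorem map_rot_mem_gamma {ρ : Mat} (h : ρ ∈ beta) : ρ.submatrix rot rot ∈ gamma :=
  map_rot_mem (by rintro _ ⟨x, y, rfl⟩; exact ⟨x, y, rfl⟩) h

theorem xMat_submatrix_rot (d : Idx → ℝ) (w : Idx → ℂ) :
    (xMat d w).submatrix rot rot = xMat (d ∘ rot) (w ∘ rot) := by
  ext p q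
  have : rot q = bar (rot p) ↔ q = bar p := by
    rw [show bar (rot p) = rot (bar p) from rfl, rot.injective.eq_iff]
  simp only [xMat, Matrix.submatrix_apply, Matrix.of_apply, rot.injective.eq_iff, this,
    Function.comp_apply]

/-- Flip the second bit of a basis label. -/
def flipB (p : Idx) : Idx := (p.1, p.2.1 + 1, p.2.2)

/-- Flip the third bit of a basis label. -/
def flipC (p : Idx) : Idx := (p.1, p.2.1, p.2.2 + 1)

theorem xMat_mem_beta {d : Idx → ℝ} {w : Idx → ℂ} (hd : ∀ p, 0 ≤ d p)
    (hw : ∀ p, w (bar p) = star (w p)) (h : ∀ p, ‖w p‖ ^ 2 ≤ d p * d (bar p))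
    (h' : ∀ p, ‖w (flipB p)‖ ^ 2 ≤ d p * d (bar p)) : xMat d w ∈ beta := by
  have := map_rot_mem_beta (xMat_mem_alpha (d := d ∘ rot.symm) (w := w ∘ rot.symm)
    (fun p => hd _) (fun p => hw (rot.symm p)) (fun p => h _) (fun p => h' (rot.symm p)))
  rwa [xMat_submatrix_rot] at this

theorem xMat_mem_gamma {d : Idx → ℝ} {w : Idx → ℂ} (hd : ∀ p, 0 ≤ d p)
    (hw : ∀ p, w (bar p) = star (w p)) (h : ∀ p, ‖w p‖ ^ 2 ≤ d p * d (bar p))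
    (h' : ∀ p, ‖w (flipC p)‖ ^ 2 ≤ d p * d (bar p)) : xMat d w ∈ gamma := by
  have := map_rot_mem_gamma (xMat_mem_beta (d := d ∘ rot.symm) (w := w ∘ rot.symm)
    (fun p => hd _) (fun p => hw (rot.symm p)) (fun p => h _) (fun p => h' (rot.symm p)))
  rwa [xMat_submatrix_rot] at this

/-! ### The four anti-diagonal indices and their involutions -/

/-- The permutation of the anti-diagonal indices induced by the partial transpose of `A`. -/
def matchA : Fin 4 → Fin 4 := ![3, 2, 1, 0]

/-- The permutation of the anti-diagonal indices induced by the partial transpose of `B`. -/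
def matchB : Fin 4 → Fin 4 := ![2, 3, 0, 1]

/-- The permutation of the anti-diagonal indices induced by the partial transpose of `C`. -/
def matchC : Fin 4 → Fin 4 := ![1, 0, 3, 2]

/-- The anti-diagonal index of the row `p`. -/
def antiIdx (p : Idx) : Fin 4 :=
  ![![![0, 1], ![2, 3]], ![![3, 2], ![1, 0]]] p.1 p.2.1 p.2.2

/-- The diagonal of `X a b z`. -/
def diagX (a b : Fin 4 → ℝ) (p : Idx) : ℝ := if p.1 = 0 then a (antiIdx p) else b (antiIdx p)

/-- The anti-diagonal of `X a b z`. -/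
def antiX (z : Fin 4 → ℂ) (p : Idx) : ℂ := if p.1 = 0 then z (antiIdx p) else star (z (antiIdx p))

theorem X_eq_xMat (a b : Fin 4 → ℝ) (z : Fin 4 → ℂ) : X a b z = xMat (diagX a b) (antiX z) := by
  ext ⟨p1, p2, p3⟩ ⟨q1, q2, q3⟩
  fin_cases p1 <;> fin_cases p2 <;> fin_cases p3 <;> fin_cases q1 <;>
    fin_cases q2 <;> fin_cases q3 <;> simp [X, xMat, lex, bar, diagX, antiX, antiIdx]

theorem antiIdx_bar (p : Idx) : antiIdx (bar p) = antiIdx p := by revert p; decide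

theorem antiIdx_flipA (p : Idx) : antiIdx (flipA p) = matchA (antiIdx p) := by revert p; decide

theorem antiIdx_flipB (p : Idx) : antiIdx (flipB p) = matchB (antiIdx p) := by revert p; decide

theorem antiIdx_flipC (p : Idx) : antiIdx (flipC p) = matchC (antiIdx p) := by revert p; decide

theorem bar_fst_eq_zero (p : Idx) : (bar p).1 = 0 ↔ ¬ p.1 = 0 := by revert p; decide

theorem norm_antiX (z : Fin 4 → ℂ) (p : Idx) : ‖antiX z p‖ = ‖z (antiIdx p)‖ := by
  unfold antiX; split_ifs <;> simp

theorem antiX_bar (z : Fin 4 → ℂ) (p : Idx) : antiX z (bar p) = star (antiX z p) := by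
  simp only [antiX, bar_fst_eq_zero, antiIdx_bar]
  split_ifs <;> simp

theorem diagX_mul_bar (a b : Fin 4 → ℝ) (p : Idx) :
    diagX a b p * diagX a b (bar p) = a (antiIdx p) * b (antiIdx p) := by
  simp only [diagX, bar_fst_eq_zero, antiIdx_bar]
  split_ifs
  · rfl
  · exact mul_comm _ _

theorem diagX_nonneg {a b : Fin 4 → ℝ} (ha : ∀ i, 0 ≤ a i) (hb : ∀ i, 0 ≤ b i) (p : Idx) :
    0 ≤ diagX a b p := by
  unfold diagX; split_ifs <;> simp [ha, hb]

theorem norm_antiX_sq_le {a b : Fin 4 → ℝ} {z : Fin 4 → ℂ} (ha : ∀ i, 0 ≤ a i)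
    (hb : ∀ i, 0 ≤ b i) {p q : Idx} (h : ‖z (antiIdx q)‖ ≤ √(a (antiIdx p) * b (antiIdx p))) :
    ‖antiX z q‖ ^ 2 ≤ diagX a b p * diagX a b (bar p) := by
  rw [norm_antiX, diagX_mul_bar]
  exact (Real.le_sqrt (norm_nonneg _) (mul_nonneg (ha _) (hb _))).1 h

/-- Every `r p` is bounded by every `s q`, except possibly by `s (m p)`. -/
def Dominates (m : Fin 4 → Fin 4) (s r : Fin 4 → ℝ) : Prop := ∀ p q, q ≠ m p → r p ≤ s q

theorem X_mem_alpha {a b : Fin 4 → ℝ} {z : Fin 4 → ℂ} (ha : ∀ i, 0 ≤ a i) (hb : ∀ i, 0 ≤ b i)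
    (h : ∀ i, ‖z i‖ ≤ √(a i * b i)) (h' : ∀ i, ‖z (matchA i)‖ ≤ √(a i * b i)) :
    X a b z ∈ alpha := by
  rw [X_eq_xMat]
  refine xMat_mem_alpha (diagX_nonneg ha hb) (antiX_bar z)
    (fun p => norm_antiX_sq_le ha hb (h _)) (fun p => norm_antiX_sq_le ha hb ?_)
  rw [antiIdx_flipA]; exact h' _

theorem X_mem_beta {a b : Fin 4 → ℝ} {z : Fin 4 → ℂ} (ha : ∀ i, 0 ≤ a i) (hb : ∀ i, 0 ≤ b i)
    (h : ∀ i, ‖z i‖ ≤ √(a i * b i)) (h' : ∀ i, ‖z (matchB i)‖ ≤ √(a i * b i)) :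
    X a b z ∈ beta := by
  rw [X_eq_xMat]
  refine xMat_mem_beta (diagX_nonneg ha hb) (antiX_bar z)
    (fun p => norm_antiX_sq_le ha hb (h _)) (fun p => norm_antiX_sq_le ha hb ?_)
  rw [antiIdx_flipB]; exact h' _

theorem X_mem_gamma {a b : Fin 4 → ℝ} {z : Fin 4 → ℂ} (ha : ∀ i, 0 ≤ a i) (hb : ∀ i, 0 ≤ b i)
    (h : ∀ i, ‖z i‖ ≤ √(a i * b i)) (h' : ∀ i, ‖z (matchC i)‖ ≤ √(a i * b i)) :
    X a b z ∈ gamma := by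
  rw [X_eq_xMat]
  refine xMat_mem_gamma (diagX_nonneg ha hb) (antiX_bar z)
    (fun p => norm_antiX_sq_le ha hb (h _)) (fun p => norm_antiX_sq_le ha hb ?_)
  rw [antiIdx_flipC]; exact h' _

/-! ### Sufficiency: splitting an X-matrix -/

/-- The splitting of the moduli in the presence of an entry `r i` that exceeds `s (m₃ i)`. -/
theorem exists_split {m₁ m₂ m₃ : Fin 4 → Fin 4}
    (hc : ∀ p q, q = p ∨ q = m₁ p ∨ q = m₂ p ∨ q = m₃ p)
    (hm₁ : ∀ p, m₁ (m₁ p) = p) (hm₃ : ∀ p, m₃ (m₃ p) = p)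
    {s r : Fin 4 → ℝ} (hs : ∀ i, 0 ≤ s i) (hr : ∀ i, 0 ≤ r i)
    (h : ∀ i, r i ≤ s i) (h' : ∀ i, r (m₁ i) ≤ s i)
    (h4 : ∀ i j k l, i ≠ j → k ≠ l → r i + r j ≤ s k + s l) {i : Fin 4} (hi : s (m₃ i) < r i) :
    ∃ s' r' : Fin 4 → ℝ, (∀ i, 0 ≤ s' i ∧ s' i ≤ s i) ∧ (∀ i, 0 ≤ r' i ∧ r' i ≤ r i) ∧
      Dominates m₃ s' r' ∧ Dominates m₂ (s - s') (r - r') := by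
  have hij : m₃ i ≠ i := fun e => by rw [e] at hi; exact hi.not_ge (h i)
  have h1 (p : Fin 4) : r p ≤ s (m₁ p) := by simpa [hm₁] using h' (m₁ p)
  have hδ : 0 < r i - s (m₃ i) := sub_pos.2 hi
  -- With δ = r i - s (m₃ i), the first summand takes δ from r i alone and δ from every s q with q ≠
  -- m₃ i. What remains of r i is exactly s (m₃ i).
  refine ⟨fun q => if q = m₃ i then 0 else r i - s (m₃ i),
    fun p => if p = i then r i - s (m₃ i) else 0, fun q => ?_, fun p => ?_, fun p q hq => ?_,
    fun p q hq => ?_⟩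
  · dsimp only
    split_ifs with e
    · exact ⟨le_rfl, hs q⟩
    · exact ⟨hδ.le, by linarith [h4 i (m₃ i) q (m₃ i) hij.symm e, hr (m₃ i)]⟩
  · dsimp only
    split_ifs with e
    · subst e; exact ⟨hδ.le, by linarith [hs (m₃ p)]⟩
    · exact ⟨le_rfl, hr p⟩
  · dsimp only
    split_ifs with e e' e'
    · subst e; exact absurd e' hq
    · exact le_rfl
    · exact le_rfl
    · exact hδ.le
  · simp only [Pi.sub_apply]
    split_ifs with e e' e'
    · subst e e'; linarith
    · subst e
      rcases hc p q with rfl | rfl | rfl | rfl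
      · linarith [h q]
      · linarith [h1 p]
      · exact absurd rfl hq
      · exact absurd rfl e'
    · rw [sub_zero, sub_zero]
      rcases hc p q with rfl | rfl | rfl | rfl
      · exact h q
      · exact h1 p
      · exact absurd rfl hq
      · exact absurd (by rw [← hm₃ p, e', hm₃]) e
    -- Here δ is removed from s q only, and r p ≤ s q - δ is the two-term inequality r p + r i ≤ s q
    -- + s (m₃ i).
    · linarith [h4 p i q (m₃ i) e e']

theorem exists_eq_smul_of_le {x y : ℝ} (hx : 0 ≤ x) (hxy : x ≤ y) :
    ∃ t : ℝ, 0 ≤ t ∧ t ≤ 1 ∧ t * y = x := by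
  rcases (hx.trans hxy).eq_or_lt with h | h
  · exact ⟨0, le_rfl, zero_le_one, by linarith⟩
  · exact ⟨x / y, div_nonneg hx h.le, (div_le_one h).2 hxy, div_mul_cancel₀ _ h.ne'⟩

theorem sqrt_smul_mul_smul {t x y : ℝ} (ht : 0 ≤ t) : √(t * x * (t * y)) = t * √(x * y) := by
  rw [show t * x * (t * y) = t ^ 2 * (x * y) by ring, Real.sqrt_mul (sq_nonneg t),
    Real.sqrt_sq ht]

theorem X_add (a a' b b' : Fin 4 → ℝ) (z z' : Fin 4 → ℂ) :
    X (a + a') (b + b') (z + z') = X a b z + X a' b' z' := by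
  rw [X_eq_xMat, X_eq_xMat, X_eq_xMat, ← xMat_add]
  congr 1 <;> funext p
  · simp only [diagX, Pi.add_apply]; split_ifs <;> rfl
  · simp only [antiX, Pi.add_apply]; split_ifs <;> simp

/-- Sufficiency, for cones `C₂`, `C₃` that contain the `X`-matrices with the domination property
for `m₃`, `m₂`. -/
theorem X_mem_sup {m₁ m₂ m₃ : Fin 4 → Fin 4}
    (hc : ∀ p q, q = p ∨ q = m₁ p ∨ q = m₂ p ∨ q = m₃ p)
    (hm₁ : ∀ p, m₁ (m₁ p) = p) (hm₂ : ∀ p, m₂ (m₂ p) = p) (hm₃ : ∀ p, m₃ (m₃ p) = p)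
    {C₂ C₃ : PointedCone ℝ Mat}
    (hC₂ : ∀ a b z, (∀ i, 0 ≤ a i) → (∀ i, 0 ≤ b i) →
      Dominates m₃ (fun i => √(a i * b i)) (fun i => ‖z i‖) → X a b z ∈ C₂)
    (hC₃ : ∀ a b z, (∀ i, 0 ≤ a i) → (∀ i, 0 ≤ b i) →
      Dominates m₂ (fun i => √(a i * b i)) (fun i => ‖z i‖) → X a b z ∈ C₃)
    {a b : Fin 4 → ℝ} {z : Fin 4 → ℂ} (ha : ∀ i, 0 ≤ a i) (hb : ∀ i, 0 ≤ b i)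
    (h : ∀ i, ‖z i‖ ≤ √(a i * b i)) (h' : ∀ i, ‖z (m₁ i)‖ ≤ √(a i * b i)) (h4 : AllS4 a b z) :
    X a b z ∈ C₂ ⊔ C₃ := by
  have h4' : ∀ i j k l, i ≠ j → k ≠ l →
      ‖z i‖ + ‖z j‖ ≤ √(a k * b k) + √(a l * b l) := by
    intro i j k l hij hkl
    -- S₄ covers different pairs only; for equal pairs the bound holds term by term.
    by_cases e : ({i, j} : Finset (Fin 4)) = {k, l}
    · have hi : i ∈ ({k, l} : Finset (Fin 4)) := e ▸ by simp
      have hj : j ∈ ({k, l} : Finset (Fin 4)) := e ▸ by simp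
      simp only [Finset.mem_insert, Finset.mem_singleton] at hi hj
      rcases hi with rfl | rfl <;> rcases hj with rfl | rfl
      · exact absurd rfl hij
      · exact add_le_add (h _) (h _)
      · rw [add_comm]; exact add_le_add (h _) (h _)
      · exact absurd rfl hij
    · exact (le_max_left _ _).trans ((h4 i j k l hij hkl e).trans (min_le_right _ _))
  have main {m m' : Fin 4 → Fin 4} {C C' : PointedCone ℝ Mat}
      (hC : ∀ a b z, (∀ i, 0 ≤ a i) → (∀ i, 0 ≤ b i) →
        Dominates m (fun i => √(a i * b i)) (fun i => ‖z i‖) → X a b z ∈ C)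
      (hC' : ∀ a b z, (∀ i, 0 ≤ a i) → (∀ i, 0 ≤ b i) →
        Dominates m' (fun i => √(a i * b i)) (fun i => ‖z i‖) → X a b z ∈ C')
      (hsp : ∃ s' r' : Fin 4 → ℝ, (∀ i, 0 ≤ s' i ∧ s' i ≤ √(a i * b i)) ∧
        (∀ i, 0 ≤ r' i ∧ r' i ≤ ‖z i‖) ∧ Dominates m s' r' ∧
        Dominates m' ((fun i => √(a i * b i)) - s') ((fun i => ‖z i‖) - r')) :
      X a b z ∈ C ⊔ C' := by
    obtain ⟨s', r', hs', hr', hd, hd'⟩ := hsp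
    choose t ht0 ht1 ht using fun i => exists_eq_smul_of_le (hs' i).1 (hs' i).2
    choose u hu0 hu1 hu using fun i => exists_eq_smul_of_le (hr' i).1 (hr' i).2
    -- Scaling aᵢ and bᵢ by tᵢ scales √(aᵢbᵢ) by tᵢ, so the moduli split as prescribed and all
    -- phases are kept.
    have e : X a b z = X (fun i => t i * a i) (fun i => t i * b i) (fun i => u i * z i) +
        X (fun i => (1 - t i) * a i) (fun i => (1 - t i) * b i)
          (fun i => ((1 - u i : ℝ) : ℂ) * z i) := by
      rw [← X_add]
      congr 1 <;> funext i <;> simp only [Pi.add_apply] <;> push_cast <;> ring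
    have ht1' (i) : 0 ≤ 1 - t i := sub_nonneg.2 (ht1 i)
    have hu1' (i) : 0 ≤ 1 - u i := sub_nonneg.2 (hu1 i)
    rw [e]
    refine Submodule.add_mem_sup (hC _ _ _ (fun i => mul_nonneg (ht0 i) (ha i))
      (fun i => mul_nonneg (ht0 i) (hb i)) fun p q hq => ?_) (hC' _ _ _
      (fun i => mul_nonneg (ht1' i) (ha i)) (fun i => mul_nonneg (ht1' i) (hb i)) fun p q hq => ?_)
    · dsimp only
      rw [sqrt_smul_mul_smul (ht0 q), norm_mul, Complex.norm_of_nonneg (hu0 p), ht, hu]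
      exact hd p q hq
    · dsimp only
      rw [sqrt_smul_mul_smul (ht1' q), norm_mul, Complex.norm_of_nonneg (hu1' p), sub_mul, sub_mul,
        ht, hu, one_mul, one_mul]
      exact hd' p q hq
  have hs (i) : 0 ≤ √(a i * b i) := Real.sqrt_nonneg _
  have hr (i) : 0 ≤ ‖z i‖ := norm_nonneg _
  by_cases h3 : ∃ i, √(a (m₃ i) * b (m₃ i)) < ‖z i‖
  · obtain ⟨i, hi⟩ := h3
    exact main hC₂ hC₃ (exists_split hc hm₁ hm₃ hs hr h h' h4' hi)
  by_cases h2 : ∃ i, √(a (m₂ i) * b (m₂ i)) < ‖z i‖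
  · obtain ⟨i, hi⟩ := h2
    rw [sup_comm]
    exact main hC₃ hC₂ (exists_split (fun p q => by have := hc p q; tauto) hm₁ hm₂ hs hr h h' h4' hi)
  -- With no excess on either side, every r p is at most every s q, and one cone suffices.
  push Not at h2 h3
  refine Submodule.mem_sup_left (hC₂ a b z ha hb fun p q _ => ?_)
  rcases hc p q with rfl | rfl | rfl | rfl
  · exact h q
  · simpa [hm₁] using h' (m₁ p)
  · exact h2 p
  · exact h3 p

/-! ### Necessity: convexity of the bounds -/

/-- The row of the `i`-th entry of the upper half of the anti-diagonal. -/
def row : Fin 4 → Idx := ![(0, 0, 0), (0, 0, 1), (0, 1, 0), (0, 1, 1)]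

/-- The geometric mean of the `i`-th pair of diagonal entries. -/
def diagMean (ρ : Mat) (i : Fin 4) : ℝ :=
  √((ρ (row i) (row i)).re * (ρ (bar (row i)) (bar (row i))).re)

/-- The modulus of the `i`-th anti-diagonal entry. -/
def antiNorm (ρ : Mat) (i : Fin 4) : ℝ := ‖ρ (row i) (bar (row i))‖

theorem antiNorm_add_le (ρ σ : Mat) (i : Fin 4) :
    antiNorm (ρ + σ) i ≤ antiNorm ρ i + antiNorm σ i := norm_add_le _ _

/-- Cauchy–Schwarz for (√x, √x') and (√y, √y'). -/
theorem sqrt_mul_add_sqrt_mul_le {x y x' y' : ℝ} (hx : 0 ≤ x) (hy : 0 ≤ y) (hx' : 0 ≤ x')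
    (hy' : 0 ≤ y') : √(x * y) + √(x' * y') ≤ √((x + x') * (y + y')) := by
  apply Real.le_sqrt_of_sq_le
  rw [Real.sqrt_mul hx, Real.sqrt_mul hx']
  have e := Real.sq_sqrt hx
  have e' := Real.sq_sqrt hx'
  have f := Real.sq_sqrt hy
  have f' := Real.sq_sqrt hy'
  nlinarith [sq_nonneg (√x * √y' - √x' * √y)]

/-- The diagonal entries are nonnegative. -/
def DiagNonneg (ρ : Mat) : Prop := ∀ p, 0 ≤ (ρ p p).re

theorem diagMean_add_le {ρ σ : Mat} (hρ : DiagNonneg ρ) (hσ : DiagNonneg σ) (i : Fin 4) :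
    diagMean ρ i + diagMean σ i ≤ diagMean (ρ + σ) i :=
  sqrt_mul_add_sqrt_mul_le (hρ _) (hρ _) (hσ _) (hσ _)

theorem rankOne_apply_self_re (ψ : Idx → ℂ) (p : Idx) : (rankOne ψ p p).re = ‖ψ p‖ ^ 2 := by
  have : rankOne ψ p p = (‖ψ p‖ ^ 2 : ℝ) := by
    push_cast
    exact Complex.mul_conj' _
  rw [this, Complex.ofReal_re]

/-- On a generator all the bounds are equalities, since flipping the bits of one tensor factor only
rearranges the product |ψ p||ψ (bar p)|. Homogeneity, subadditivity of `antiNorm` and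
superadditivity of `diagMean` carry them to the hull. -/
theorem bounds_of_mem_hull {S : Set Mat} {m : Fin 4 → Fin 4}
    (hS : ∀ ρ ∈ S, ∃ ψ, ρ = rankOne ψ ∧
      ∀ i, ‖ψ (row (m i))‖ * ‖ψ (bar (row (m i)))‖ = ‖ψ (row i)‖ * ‖ψ (bar (row i))‖)
    {ρ : Mat} (h : ρ ∈ PointedCone.hull ℝ S) :
    DiagNonneg ρ ∧ ∀ i, antiNorm ρ i ≤ diagMean ρ i ∧ antiNorm ρ (m i) ≤ diagMean ρ i := by
  induction h using Submodule.span_induction with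
  | mem ρ h =>
    obtain ⟨ψ, rfl, hψ⟩ := hS ρ h
    have ha (i) : antiNorm (rankOne ψ) i = ‖ψ (row i)‖ * ‖ψ (bar (row i))‖ := by
      simp [antiNorm, rankOne, Matrix.vecMulVec_apply]
    have hd (i) : diagMean (rankOne ψ) i = ‖ψ (row i)‖ * ‖ψ (bar (row i))‖ := by
      rw [diagMean, rankOne_apply_self_re, rankOne_apply_self_re, ← mul_pow,
        Real.sqrt_sq (by positivity)]
    refine ⟨fun p => ?_, fun i => ?_⟩
    · rw [rankOne_apply_self_re]; positivity
    · rw [ha, ha, hd, hψ]; exact ⟨le_rfl, le_rfl⟩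
  | zero => simp [DiagNonneg, antiNorm, diagMean]
  | add ρ σ _ _ hρ hσ =>
    refine ⟨fun p => add_nonneg (hρ.1 p) (hσ.1 p), fun i => ?_⟩
    have := diagMean_add_le hρ.1 hσ.1 i
    exact ⟨by linarith [antiNorm_add_le ρ σ i, (hρ.2 i).1, (hσ.2 i).1],
      by linarith [antiNorm_add_le ρ σ (m i), (hρ.2 i).2, (hσ.2 i).2]⟩
  | smul t ρ _ hρ =>
    have ht : 0 ≤ (t : ℝ) := t.2
    have hd (p) : ((t • ρ) p p).re = t * (ρ p p).re := by
      change (((t : ℝ) • ρ p p).re) = _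
      rw [Complex.smul_re, smul_eq_mul]
    have hm (i) : diagMean (t • ρ) i = t * diagMean ρ i := by
      rw [diagMean, hd, hd, sqrt_smul_mul_smul ht, diagMean]
    have ha (i) : antiNorm (t • ρ) i = t * antiNorm ρ i := by
      change ‖(t : ℝ) • ρ (row i) (bar (row i))‖ = _
      rw [norm_smul, Real.norm_of_nonneg ht, antiNorm]
    refine ⟨fun p => ?_, fun i => ?_⟩
    · rw [hd]; exact mul_nonneg ht (hρ.1 p)
    · rw [hm, ha, ha]
      exact ⟨mul_le_mul_of_nonneg_left (hρ.2 i).1 ht, mul_le_mul_of_nonneg_left (hρ.2 i).2 ht⟩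

theorem bounds_of_mem_alpha {ρ : Mat} (h : ρ ∈ alpha) :
    DiagNonneg ρ ∧ ∀ i, antiNorm ρ i ≤ diagMean ρ i ∧ antiNorm ρ (matchA i) ≤ diagMean ρ i := by
  refine bounds_of_mem_hull ?_ h
  rintro _ ⟨x, y, rfl⟩
  refine ⟨_, rfl, fun i => ?_⟩
  fin_cases i <;> simp [row, bar, matchA] <;> ring

theorem bounds_of_mem_beta {ρ : Mat} (h : ρ ∈ beta) :
    DiagNonneg ρ ∧ ∀ i, antiNorm ρ i ≤ diagMean ρ i ∧ antiNorm ρ (matchB i) ≤ diagMean ρ i := by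
  refine bounds_of_mem_hull ?_ h
  rintro _ ⟨x, y, rfl⟩
  refine ⟨_, rfl, fun i => ?_⟩
  fin_cases i <;> simp [row, bar, matchB] <;> ring

theorem bounds_of_mem_gamma {ρ : Mat} (h : ρ ∈ gamma) :
    DiagNonneg ρ ∧ ∀ i, antiNorm ρ i ≤ diagMean ρ i ∧ antiNorm ρ (matchC i) ≤ diagMean ρ i := by
  refine bounds_of_mem_hull ?_ h
  rintro _ ⟨x, y, rfl⟩
  refine ⟨_, rfl, fun i => ?_⟩
  fin_cases i <;> simp [row, bar, matchC] <;> ring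

theorem dominates_of_bounds {m₁ m₂ m₃ : Fin 4 → Fin 4}
    (hc : ∀ p q, q = p ∨ q = m₁ p ∨ q = m₂ p ∨ q = m₃ p)
    (hm₁ : ∀ p, m₁ (m₁ p) = p) (hm₂ : ∀ p, m₂ (m₂ p) = p) {s r : Fin 4 → ℝ}
    (h : ∀ i, r i ≤ s i) (h₁ : ∀ i, r (m₁ i) ≤ s i) (h₂ : ∀ i, r (m₂ i) ≤ s i) :
    Dominates m₃ s r := by
  intro p q hq
  rcases hc p q with rfl | rfl | rfl | rfl
  · exact h q
  · simpa [hm₁] using h₁ (m₁ p)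
  · simpa [hm₂] using h₂ (m₂ p)
  · exact absurd rfl hq

/-- Each of i, j has one forbidden partner, and these differ. Hence one of the two ways to pair i, j
with k, l avoids both. -/
theorem Dominates.add_le_add {m : Fin 4 → Fin 4} (hm : ∀ p, m (m p) = p) {s r : Fin 4 → ℝ}
    (h : Dominates m s r) {i j k l : Fin 4} (hij : i ≠ j) (hkl : k ≠ l) :
    r i + r j ≤ s k + s l := by
  have hinj : m i ≠ m j := fun e => hij (by rw [← hm i, e, hm])
  by_cases hk : k = m i ∨ l = m j
  · have h1 : l ≠ m i := by rcases hk with rfl | rfl; exacts [hkl.symm, hinj.symm]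
    have h2 : k ≠ m j := by rcases hk with rfl | rfl; exacts [hinj, hkl]
    linarith [h i l h1, h j k h2]
  · push Not at hk
    linarith [h i k hk.1, h j l hk.2]

/-- Necessity, in terms of the moduli. -/
theorem bounds_of_mem_sup {m₁ m₂ m₃ : Fin 4 → Fin 4}
    (hc : ∀ p q, q = p ∨ q = m₁ p ∨ q = m₂ p ∨ q = m₃ p)
    (hm₁ : ∀ p, m₁ (m₁ p) = p) (hm₂ : ∀ p, m₂ (m₂ p) = p) (hm₃ : ∀ p, m₃ (m₃ p) = p)
    {C₁ C₂ C₃ : PointedCone ℝ Mat}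
    (h₁ : ∀ ρ ∈ C₁, DiagNonneg ρ ∧
      ∀ i, antiNorm ρ i ≤ diagMean ρ i ∧ antiNorm ρ (m₁ i) ≤ diagMean ρ i)
    (h₂ : ∀ ρ ∈ C₂, DiagNonneg ρ ∧
      ∀ i, antiNorm ρ i ≤ diagMean ρ i ∧ antiNorm ρ (m₂ i) ≤ diagMean ρ i)
    (h₃ : ∀ ρ ∈ C₃, DiagNonneg ρ ∧
      ∀ i, antiNorm ρ i ≤ diagMean ρ i ∧ antiNorm ρ (m₃ i) ≤ diagMean ρ i)
    {ρ : Mat} (h : ρ ∈ (C₁ ⊓ C₂) ⊔ (C₁ ⊓ C₃)) :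
    (∀ i, antiNorm ρ i ≤ diagMean ρ i ∧ antiNorm ρ (m₁ i) ≤ diagMean ρ i) ∧
      ∀ i j k l, i ≠ j → k ≠ l →
        antiNorm ρ i + antiNorm ρ j ≤ diagMean ρ k + diagMean ρ l := by
  refine ⟨(h₁ ρ ((sup_le inf_le_left inf_le_left : (C₁ ⊓ C₂) ⊔ (C₁ ⊓ C₃) ≤ C₁) h)).2, fun i j k l hij hkl => ?_⟩
  obtain ⟨σ, hσ, τ, hτ, rfl⟩ := Submodule.mem_sup.1 h
  have s₁ := h₁ σ hσ.1
  have s₂ := h₂ σ hσ.2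
  have t₁ := h₁ τ hτ.1
  have t₃ := h₃ τ hτ.2
  have hs := (dominates_of_bounds hc hm₁ hm₂ (fun i => (s₁.2 i).1) (fun i => (s₁.2 i).2)
    (fun i => (s₂.2 i).2)).add_le_add hm₃ hij hkl
  have ht := (dominates_of_bounds (m₃ := m₂) (fun p q => by have := hc p q; tauto) hm₁ hm₃
    (fun i => (t₁.2 i).1) (fun i => (t₁.2 i).2) (fun i => (t₃.2 i).2)).add_le_add hm₂ hij hkl
  linarith [antiNorm_add_le σ τ i, antiNorm_add_le σ τ j, diagMean_add_le s₁.1 t₁.1 k,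
    diagMean_add_le s₁.1 t₁.1 l]

/-! ### From the entries of the X-part to S₁ and S₄ -/

theorem xPart_apply_self (ρ : Mat) (p : Idx) : xPart ρ p p = ρ p p := by simp [xPart]

theorem xPart_apply_bar (ρ : Mat) (p : Idx) : xPart ρ p (bar p) = ρ p (bar p) := by
  have : lex (bar p) = (lex p).rev := by revert p; decide
  simp [xPart, this]

theorem antiNorm_eq {ρ : Mat} {a b : Fin 4 → ℝ} {z : Fin 4 → ℂ} (h : xPart ρ = X a b z)
    (i : Fin 4) : antiNorm ρ i = ‖z i‖ := by
  rw [antiNorm, ← xPart_apply_bar ρ (row i), h, X_eq_xMat]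
  fin_cases i <;> simp [xMat, row, bar, antiX, antiIdx]

theorem apply_row {ρ : Mat} {a b : Fin 4 → ℝ} {z : Fin 4 → ℂ} (h : xPart ρ = X a b z)
    (i : Fin 4) : ρ (row i) (row i) = a i := by
  rw [← xPart_apply_self ρ (row i), h, X_eq_xMat]
  fin_cases i <;> simp [xMat, row, diagX, antiIdx]

theorem apply_bar_row {ρ : Mat} {a b : Fin 4 → ℝ} {z : Fin 4 → ℂ} (h : xPart ρ = X a b z)
    (i : Fin 4) : ρ (bar (row i)) (bar (row i)) = b i := by
  rw [← xPart_apply_self ρ (bar (row i)), h, X_eq_xMat]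
  fin_cases i <;> simp [xMat, row, bar, diagX, antiIdx]

theorem diagMean_eq {ρ : Mat} {a b : Fin 4 → ℝ} {z : Fin 4 → ℂ} (h : xPart ρ = X a b z)
    (i : Fin 4) : diagMean ρ i = √(a i * b i) := by
  rw [diagMean, apply_row h, apply_bar_row h, Complex.ofReal_re, Complex.ofReal_re]

theorem forall_bounds_iff_S1_matchA {a b : Fin 4 → ℝ} {z : Fin 4 → ℂ} :
    (∀ i, ‖z i‖ ≤ √(a i * b i) ∧ ‖z (matchA i)‖ ≤ √(a i * b i)) ↔ S1 a b z 0 3 ∧ S1 a b z 1 2 := by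
  simp only [Fin.forall_fin_succ, S1, ge_iff_le, le_min_iff, max_le_iff, matchA]
  simp
  tauto

theorem forall_bounds_iff_S1_matchB {a b : Fin 4 → ℝ} {z : Fin 4 → ℂ} :
    (∀ i, ‖z i‖ ≤ √(a i * b i) ∧ ‖z (matchB i)‖ ≤ √(a i * b i)) ↔ S1 a b z 0 2 ∧ S1 a b z 1 3 := by
  simp only [Fin.forall_fin_succ, S1, ge_iff_le, le_min_iff, max_le_iff, matchB]
  simp
  tauto

theorem forall_bounds_iff_S1_matchC {a b : Fin 4 → ℝ} {z : Fin 4 → ℂ} :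
    (∀ i, ‖z i‖ ≤ √(a i * b i) ∧ ‖z (matchC i)‖ ≤ √(a i * b i)) ↔ S1 a b z 0 1 ∧ S1 a b z 2 3 := by
  simp only [Fin.forall_fin_succ, S1, ge_iff_le, le_min_iff, max_le_iff, matchC]
  simp
  tauto

theorem allS4_of_forall {a b : Fin 4 → ℝ} {z : Fin 4 → ℂ}
    (h : ∀ i j k l, i ≠ j → k ≠ l → ‖z i‖ + ‖z j‖ ≤ √(a k * b k) + √(a l * b l)) :
    AllS4 a b z := fun _ _ _ _ hij hkl _ =>
  le_min (max_le (h _ _ _ _ hij hij) (h _ _ _ _ hkl hij))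
    (max_le (h _ _ _ _ hij hkl) (h _ _ _ _ hkl hkl))

theorem matchA_matchA (p : Fin 4) : matchA (matchA p) = p := by revert p; decide

theorem matchB_matchB (p : Fin 4) : matchB (matchB p) = p := by revert p; decide

theorem matchC_matchC (p : Fin 4) : matchC (matchC p) = p := by revert p; decide

theorem eq_match (p q : Fin 4) : q = p ∨ q = matchA p ∨ q = matchB p ∨ q = matchC p := by
  revert p q; decide

/-- The values of q other than `matchC p` are p, `matchA p` and `matchB p`, which give just the
bounds required by the two cones. -/
theorem X_mem_alpha_inf_beta (a b : Fin 4 → ℝ) (z : Fin 4 → ℂ) (ha : ∀ i, 0 ≤ a i)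
    (hb : ∀ i, 0 ≤ b i) (h : Dominates matchC (fun i => √(a i * b i)) fun i => ‖z i‖) :
    X a b z ∈ alpha ⊓ beta :=
  ⟨X_mem_alpha ha hb (fun i => h i i (by revert i; decide)) fun i => h _ i (by revert i; decide),
    X_mem_beta ha hb (fun i => h i i (by revert i; decide)) fun i => h _ i (by revert i; decide)⟩

theorem X_mem_beta_inf_gamma (a b : Fin 4 → ℝ) (z : Fin 4 → ℂ) (ha : ∀ i, 0 ≤ a i)
    (hb : ∀ i, 0 ≤ b i) (h : Dominates matchA (fun i => √(a i * b i)) fun i => ‖z i‖) :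
    X a b z ∈ beta ⊓ gamma :=
  ⟨X_mem_beta ha hb (fun i => h i i (by revert i; decide)) fun i => h _ i (by revert i; decide),
    X_mem_gamma ha hb (fun i => h i i (by revert i; decide)) fun i => h _ i (by revert i; decide)⟩

theorem X_mem_gamma_inf_alpha (a b : Fin 4 → ℝ) (z : Fin 4 → ℂ) (ha : ∀ i, 0 ≤ a i)
    (hb : ∀ i, 0 ≤ b i) (h : Dominates matchB (fun i => √(a i * b i)) fun i => ‖z i‖) :
    X a b z ∈ gamma ⊓ alpha :=
  ⟨X_mem_gamma ha hb (fun i => h i i (by revert i; decide)) fun i => h _ i (by revert i; decide),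
    X_mem_alpha ha hb (fun i => h i i (by revert i; decide)) fun i => h _ i (by revert i; decide)⟩

end ThreeQubit

end

open ThreeQubit in
theorem theorem3p1 (ρ : ThreeQubit.Mat) (hρ : ρ.PosSemidef)
    (a b : Fin 4 → ℝ) (z : Fin 4 → ℂ) (hX : ThreeQubit.xPart ρ = ThreeQubit.X a b z) :
    ((ρ ∈ (ThreeQubit.alpha ⊓ ThreeQubit.beta) ⊔ (ThreeQubit.alpha ⊓ ThreeQubit.gamma) →
        ThreeQubit.S1 a b z 0 3 ∧ ThreeQubit.S1 a b z 1 2 ∧ ThreeQubit.AllS4 a b z) ∧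
      (ρ ∈ (ThreeQubit.beta ⊓ ThreeQubit.gamma) ⊔ (ThreeQubit.beta ⊓ ThreeQubit.alpha) →
        ThreeQubit.S1 a b z 0 2 ∧ ThreeQubit.S1 a b z 1 3 ∧ ThreeQubit.AllS4 a b z) ∧
      (ρ ∈ (ThreeQubit.gamma ⊓ ThreeQubit.alpha) ⊔ (ThreeQubit.gamma ⊓ ThreeQubit.beta) →
        ThreeQubit.S1 a b z 0 1 ∧ ThreeQubit.S1 a b z 2 3 ∧ ThreeQubit.AllS4 a b z)) ∧
    (ρ = ThreeQubit.X a b z →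
      (ThreeQubit.S1 a b z 0 3 ∧ ThreeQubit.S1 a b z 1 2 ∧ ThreeQubit.AllS4 a b z →
        ρ ∈ (ThreeQubit.alpha ⊓ ThreeQubit.beta) ⊔ (ThreeQubit.alpha ⊓ ThreeQubit.gamma)) ∧
      (ThreeQubit.S1 a b z 0 2 ∧ ThreeQubit.S1 a b z 1 3 ∧ ThreeQubit.AllS4 a b z →
        ρ ∈ (ThreeQubit.beta ⊓ ThreeQubit.gamma) ⊔ (ThreeQubit.beta ⊓ ThreeQubit.alpha)) ∧
      (ThreeQubit.S1 a b z 0 1 ∧ ThreeQubit.S1 a b z 2 3 ∧ ThreeQubit.AllS4 a b z →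
        ρ ∈ (ThreeQubit.gamma ⊓ ThreeQubit.alpha) ⊔ (ThreeQubit.gamma ⊓ ThreeQubit.beta))) := by
  -- Positivity enters through the diagonal: it makes √(aᵢbᵢ) a genuine geometric mean, as the
  -- converses need.
  have hne : (∀ i, 0 ≤ a i) ∧ ∀ i, 0 ≤ b i := by
    refine ⟨fun i => ?_, fun i => ?_⟩
    · have := hρ.diag_nonneg (i := row i)
      rw [apply_row hX] at this
      exact_mod_cast this
    · have := hρ.diag_nonneg (i := bar (row i))
      rw [apply_bar_row hX] at this
      exact_mod_cast this
  obtain ⟨ha, hb⟩ := hne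
  refine ⟨⟨fun h => ?_, fun h => ?_, fun h => ?_⟩, ?_⟩
  · have := bounds_of_mem_sup eq_match matchA_matchA matchB_matchB matchC_matchC
      (fun _ => bounds_of_mem_alpha) (fun _ => bounds_of_mem_beta) (fun _ => bounds_of_mem_gamma) h
    simp only [antiNorm_eq hX, diagMean_eq hX] at this
    rw [← and_assoc, ← forall_bounds_iff_S1_matchA]
    exact ⟨this.1, allS4_of_forall this.2⟩
  · have := bounds_of_mem_sup (fun p q => by have := eq_match p q; tauto)
      matchB_matchB matchC_matchC matchA_matchA
      (fun _ => bounds_of_mem_beta) (fun _ => bounds_of_mem_gamma) (fun _ => bounds_of_mem_alpha) h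
    simp only [antiNorm_eq hX, diagMean_eq hX] at this
    rw [← and_assoc, ← forall_bounds_iff_S1_matchB]
    exact ⟨this.1, allS4_of_forall this.2⟩
  · have := bounds_of_mem_sup (fun p q => by have := eq_match p q; tauto)
      matchC_matchC matchA_matchA matchB_matchB
      (fun _ => bounds_of_mem_gamma) (fun _ => bounds_of_mem_alpha) (fun _ => bounds_of_mem_beta) h
    simp only [antiNorm_eq hX, diagMean_eq hX] at this
    rw [← and_assoc, ← forall_bounds_iff_S1_matchC]
    exact ⟨this.1, allS4_of_forall this.2⟩
  · rintro rfl
    simp only [← and_assoc, ← forall_bounds_iff_S1_matchA, ← forall_bounds_iff_S1_matchB,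
      ← forall_bounds_iff_S1_matchC]
    refine ⟨⟨fun h => ?_, fun h => ?_⟩, fun h => ?_⟩
    · rw [inf_comm alpha gamma]
      exact X_mem_sup eq_match matchA_matchA matchB_matchB matchC_matchC X_mem_alpha_inf_beta
        X_mem_gamma_inf_alpha ha hb (fun i => (h.1 i).1) (fun i => (h.1 i).2) h.2
    · rw [inf_comm beta alpha]
      exact X_mem_sup (fun p q => by have := eq_match p q; tauto) matchB_matchB matchC_matchC
        matchA_matchA X_mem_beta_inf_gamma X_mem_alpha_inf_beta ha hb (fun i => (h.1 i).1)
        (fun i => (h.1 i).2) h.2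
    · rw [inf_comm gamma beta]
      exact X_mem_sup (fun p q => by have := eq_match p q; tauto) matchC_matchC matchA_matchA
        matchB_matchB X_mem_gamma_inf_alpha X_mem_beta_inf_gamma ha hb (fun i => (h.1 i).1)
        (fun i => (h.1 i).2) h.2
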